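/- For $a\in\mathbb B^n$ put $s=\sqrt{1-\|a\|^2}$, $L_a(z)=\frac{\langle z,a\rangle}{s+1}\,a+s\,z$ and $\phi_a(z)=\frac{a-L_a(z)}{1-\langle z,a\rangle}$, where $\mathbb B^n$ is the open unit ball of $\mathbb C^n$ and $\langle z,a\rangle=\sum_j z_j\overline{a_j}$. For a map $f:\mathbb B^n\to\mathbb B^N$ let $\Gamma_f$ be the group of those holomorphic automorphisms $\gamma$ of $\mathbb B^n$ for which there is a holomorphic automorphism $\psi$ of $\mathbb B^N$ with $f\circ\gamma=\psi\circ f$. **Theorem.** Let $f=\frac pq:\mathbb B^n\to\mathbb B^N$ be a rational proper holomorphic map with $f(0)=0$, where $p=(p_1,\dots,p_N)$, the polynomials $p_1,\dots,p_N,q$ have no nonconstant common factor, and $q(0)=1$. Let $d=\max(\deg p_1,\dots,\deg p_N,\deg q)$ be the degree of $f$. Suppose that $\Gamma_f$ contains an automorphism $\gamma$ with $\gamma(0)\neq0$. 1. If $\gamma=U\circ\phi_a$ on $\mathbb B^n$ with $U$ a unitary map of $\mathbb C^n$ and $a\in\mathbb B^n$, then $$\bigl(\|p(a)\|^2-|q(a)|^2\bigr)\,\bigl(\|p(Ua)\|^2-|q(Ua)|^2\bigr)=(1-\|a\|^2)^{2d}.$$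 2. If $f$ is a polynomial map, then $n\le N$ and $f$ is unitarily equivalent to $z\oplus0$: there are unitary maps $V$ of $\mathbb C^N$ and $W$ of $\mathbb C^n$ such that $f(z)=V(Wz\oplus0)$ for all $z\in\mathbb B^n$. -/

import Mathlib

/-- Complex Euclidean space `ℂⁿ` with its Hermitian norm. -/
abbrev CSpace (n : ℕ) : Type := EuclideanSpace ℂ (Fin n)

/-- The open unit ball `𝔹ⁿ` of `ℂⁿ`. -/
abbrev UnitBall (n : ℕ) : Type := Metric.ball (0 : CSpace n) 1

/-- The origin of `𝔹ⁿ`. -/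
def UnitBall.origin (n : ℕ) : UnitBall n := ⟨0, Metric.mem_ball_self one_pos⟩

/-- A map between balls is holomorphic: it is the restriction to the (open) ball of a function
that is complex differentiable at every point of the ball. -/
def IsHolomorphic {n m : ℕ} (g : UnitBall n → UnitBall m) : Prop :=
  ∃ G : CSpace n → CSpace m,
    DifferentiableOn ℂ G (Metric.ball 0 1) ∧ ∀ z : UnitBall n, G z = g z

theorem IsHolomorphic.id (n : ℕ) : IsHolomorphic (fun z : UnitBall n => z) :=
  ⟨fun z => z, differentiableOn_id, fun _ => rfl⟩

theorem IsHolomorphic.comp {n m k : ℕ} {g : UnitBall m → UnitBall k} {h : UnitBall n → UnitBall m}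
    (hg : IsHolomorphic g) (hh : IsHolomorphic h) : IsHolomorphic (fun z => g (h z)) := by
  obtain ⟨G, hG, hGg⟩ := hg
  obtain ⟨H, hH, hHh⟩ := hh
  refine ⟨G ∘ H, hG.comp hH fun z hz => ?_, fun z => ?_⟩
  · rw [hHh ⟨z, hz⟩]
    exact (h ⟨z, hz⟩).2
  · rw [Function.comp_apply, hHh, hGg]

/-- `Aut(𝔹ⁿ)`: the group of biholomorphic self-maps of the unit ball. -/
def ballAut (n : ℕ) : Subgroup (Equiv.Perm (UnitBall n)) where
  carrier := {e | IsHolomorphic e ∧ IsHolomorphic e.symm}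
  mul_mem' h₁ h₂ := ⟨h₁.1.comp h₂.1, h₂.2.comp h₁.2⟩
  one_mem' := ⟨IsHolomorphic.id n, IsHolomorphic.id n⟩
  inv_mem' h := ⟨h.2, h.1⟩

/-- The Hermitian invariant group `Γ_f` of a map `f : 𝔹ⁿ → 𝔹ᴺ`: all `γ ∈ Aut(𝔹ⁿ)` for which there
is `ψ ∈ Aut(𝔹ᴺ)` with `f ∘ γ = ψ ∘ f`. -/
def hermitianInvariantGroup {n N : ℕ} (f : UnitBall n → UnitBall N) : Subgroup (ballAut n) where
  carrier := {γ | ∃ ψ : ballAut N, ∀ z, f (γ.1 z) = ψ.1 (f z)}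
  mul_mem' := by
    rintro γ₁ γ₂ ⟨ψ₁, h₁⟩ ⟨ψ₂, h₂⟩
    refine ⟨ψ₁ * ψ₂, fun z => ?_⟩
    simp only [Subgroup.coe_mul, Equiv.Perm.mul_apply, h₁, h₂]
  one_mem' := ⟨1, fun _ => rfl⟩
  inv_mem' := by
    rintro γ ⟨ψ, h⟩
    refine ⟨ψ⁻¹, fun z => ?_⟩
    have key := h (γ.1.symm z)
    rw [Equiv.apply_symm_apply] at key
    exact (ψ.1.symm_apply_eq.mpr key).symm

/-- The value of a polynomial at a point of `ℂⁿ`. -/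
noncomputable def polyEval {n : ℕ} (q : MvPolynomial (Fin n) ℂ) (z : CSpace n) : ℂ :=
  MvPolynomial.eval (fun i => z i) q

/-- The polynomial map `ℂⁿ → ℂᴺ` with components `p j`. -/
noncomputable def polyMap {n N : ℕ} (p : Fin N → MvPolynomial (Fin n) ℂ) (z : CSpace n) :
    CSpace N :=
  WithLp.toLp 2 fun j => polyEval (p j) z

/-- `f = p / q` on the ball, where the fraction is reduced to lowest terms (the polynomials
`p 0, …, p (N - 1), q` have no nonconstant common factor) and normalized by `q(0) = 1`.
The equation is written without division. -/
structure IsReducedFraction {n N : ℕ} (f : UnitBall n → UnitBall N)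
    (p : Fin N → MvPolynomial (Fin n) ℂ) (q : MvPolynomial (Fin n) ℂ) : Prop where
  eq_div : ∀ z : UnitBall n, polyEval q z • (f z : CSpace N) = polyMap p z
  lowest_terms : ∀ r : MvPolynomial (Fin n) ℂ, (∀ j, r ∣ p j) → r ∣ q → IsUnit r
  denom_zero : polyEval q 0 = 1

/-- The degree of the rational map `p / q` (for a fraction in lowest terms): the largest degree of
the numerators and the denominator. -/
noncomputable def fractionDegree {n N : ℕ} (p : Fin N → MvPolynomial (Fin n) ℂ)
    (q : MvPolynomial (Fin n) ℂ) : ℕ :=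
  max (Finset.univ.sup fun j => (p j).totalDegree) q.totalDegree

/-- The map `L_a(z) = (⟨z, a⟩ / (s + 1)) a + s z`, where `s = √(1 - ‖a‖²)`. Here `⟨z, a⟩` is linear
in `z`, which is `inner ℂ a z` in Mathlib's convention. -/
noncomputable def moebiusL {n : ℕ} (a z : CSpace n) : CSpace n :=
  (inner ℂ a z / ((√(1 - ‖a‖ ^ 2) : ℝ) + 1 : ℂ)) • a + ((√(1 - ‖a‖ ^ 2) : ℝ) : ℂ) • z

/-- The linear fractional map `φ_a(z) = (a - L_a z) / (1 - ⟨z, a⟩)`. -/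
noncomputable def moebius {n : ℕ} (a z : CSpace n) : CSpace n :=
  (1 - inner ℂ a z)⁻¹ • (a - moebiusL a z)

/-- The map `z ↦ z ⊕ 0` from `ℂⁿ` to `ℂᴺ`, used for `n ≤ N`. -/
noncomputable def sumZero (n N : ℕ) (z : CSpace n) : CSpace N :=
  WithLp.toLp 2 fun j => if h : (j : ℕ) < n then z ⟨j, h⟩ else 0

/-- A map `f` of balls is unitarily equivalent to (the restriction to the ball of) `g`:
`f = V ∘ g ∘ W` for unitary maps `W` of the source and `V` of the target. -/
def UnitarilyEquivalent {n N : ℕ} (f : UnitBall n → UnitBall N) (g : CSpace n → CSpace N) : Prop :=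
  ∃ (V : CSpace N ≃ₗᵢ[ℂ] CSpace N) (W : CSpace n ≃ₗᵢ[ℂ] CSpace n),
    ∀ z : UnitBall n, (f z : CSpace N) = V (g (W z))

/-! ### Algebra of the involutions φ_a -/

open Metric ComplexConjugate

/-! Put H = |q|² - ‖p‖². Schwarz and Cartan give ψ⁻¹ = V ∘ φ_b with V unitary
(`ballAut.exists_eq_unitary_moebius`). Clearing denominators in f = ψ⁻¹ ∘ f ∘ γ yields a second
fraction R/S for f, again of degree at most d. As p/q is in lowest terms and d is its degree, (R, S)
= c(p, q) for a constant c (`exists_eq_C_mul_of_lowest_terms`). Since φ_b, in homogeneous form,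
scales |x|² - ‖w‖² by 1 - ‖b‖² (`norm_sq_sub_moebiusL`), this gives A H(z) = B |1 - ⟨z,a⟩|^{2d}
H(γz) with A = |c|² and B = 1 - ‖b‖² > 0. Here H(0) = 1, γ(0) = Ua and γ(a) = 0, so comparing z = 0
with z = a eliminates A and B and proves the product formula.

If f is polynomial then q = 1, and Schwarz makes each factor of the product at most -(1 - ‖a‖²).
Hence (1 - ‖a‖²)² ≤ (1 - ‖a‖²)^{2d}, and a ≠ 0 forces d ≤ 1. So f is linear; properness and Schwarz
make it an isometry, which is z ⊕ 0 up to a unitary of the target. -/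

theorem inner_self_eq_coe_norm_sq {n : ℕ} (a : CSpace n) :
    inner ℂ a a = ((‖a‖ ^ 2 : ℝ) : ℂ) := by
  rw [inner_self_eq_norm_sq_to_K]
  simp

/-- Because ‖a‖² = (1 - s)(1 + s), the map L_a fixes a and multiplies the orthogonal complement of a
by s. -/
theorem inner_moebiusL {n : ℕ} {a : CSpace n} (ha : ‖a‖ < 1) (z : CSpace n) :
    inner ℂ a (moebiusL a z) = inner ℂ a z := by
  have hpos : (0 : ℝ) ≤ 1 - ‖a‖ ^ 2 := by nlinarith [norm_nonneg a]
  have hs := Real.sq_sqrt hpos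
  set s : ℝ := √(1 - ‖a‖ ^ 2) with hsdef
  have hs0 : 0 ≤ s := Real.sqrt_nonneg _
  have hs1 : (s : ℂ) + 1 ≠ 0 := by
    norm_cast
    positivity
  have haa : inner ℂ a a = (1 - (s : ℂ) ^ 2) := by
    rw [inner_self_eq_coe_norm_sq, show ‖a‖ ^ 2 = 1 - s ^ 2 by linarith]
    push_cast
    rfl
  rw [moebiusL, inner_add_right, inner_smul_right, inner_smul_right, haa, ← hsdef]
  field_simp
  ring

/-- The numerator and denominator of φ_a act on (x, z) as s times an isometry of the form |x|² -
‖z‖². Keeping x free allows polynomial pairs to be substituted without dividing. -/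
theorem norm_sq_sub_moebiusL {n : ℕ} {a : CSpace n} (ha : ‖a‖ < 1) (x : ℂ) (z : CSpace n) :
    ‖x - inner ℂ a z‖ ^ 2 - ‖x • a - moebiusL a z‖ ^ 2 =
      (1 - ‖a‖ ^ 2) * (‖x‖ ^ 2 - ‖z‖ ^ 2) := by
  have hpos : (0 : ℝ) ≤ 1 - ‖a‖ ^ 2 := by nlinarith [norm_nonneg a]
  have hs := Real.sq_sqrt hpos
  set s : ℝ := √(1 - ‖a‖ ^ 2) with hsdef
  have hs0 : 0 ≤ s := Real.sqrt_nonneg _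
  have hs1 : (s : ℂ) + 1 ≠ 0 := by
    norm_cast
    positivity
  have haa : inner ℂ a a = (1 - (s : ℂ) ^ 2) := by
    rw [inner_self_eq_coe_norm_sq, show ‖a‖ ^ 2 = 1 - s ^ 2 by linarith]
    push_cast
    rfl
  have key : (x - inner ℂ a z) * conj (x - inner ℂ a z) -
      inner ℂ (x • a - moebiusL a z) (x • a - moebiusL a z) =
      (s : ℂ) ^ 2 * (x * conj x - inner ℂ z z) := by
    have h : x • a - moebiusL a z = (x - inner ℂ a z / (s + 1)) • a - (s : ℂ) • z := by
      rw [moebiusL, sub_smul]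
      abel
    rw [h]
    simp only [inner_sub_left, inner_sub_right, inner_smul_left, inner_smul_right, haa, map_sub,
      map_div₀, map_add, map_one, Complex.conj_ofReal, inner_conj_symm]
    field_simp
    ring
  rw [inner_self_eq_coe_norm_sq, inner_self_eq_coe_norm_sq, Complex.mul_conj, Complex.mul_conj,
    Complex.normSq_eq_norm_sq, Complex.normSq_eq_norm_sq] at key
  have key' : ‖x - inner ℂ a z‖ ^ 2 - ‖x • a - moebiusL a z‖ ^ 2 =
      s ^ 2 * (‖x‖ ^ 2 - ‖z‖ ^ 2) := by
    exact_mod_cast key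
  rw [key', hs]

theorem one_sub_inner_ne_zero {n : ℕ} {a z : CSpace n} (ha : ‖a‖ < 1) (hz : ‖z‖ < 1) :
    1 - inner ℂ a z ≠ 0 := by
  intro h
  have h1 : ‖inner ℂ a z‖ ≤ ‖a‖ * ‖z‖ := norm_inner_le_norm a z
  rw [← sub_eq_zero.mp h, norm_one] at h1
  nlinarith [norm_nonneg a, norm_nonneg z]

theorem norm_moebius_lt_one {n : ℕ} {a z : CSpace n} (ha : ‖a‖ < 1) (hz : ‖z‖ < 1) :
    ‖moebius a z‖ < 1 := by
  have h := norm_sq_sub_moebiusL ha 1 z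
  have hne := norm_pos_iff.mpr (one_sub_inner_ne_zero ha hz)
  rw [one_smul, norm_one] at h
  have hpos : 0 < (1 - ‖a‖ ^ 2) * ((1 : ℝ) ^ 2 - ‖z‖ ^ 2) := by
    apply mul_pos <;> nlinarith [norm_nonneg a, norm_nonneg z]
  rw [moebius, norm_smul, norm_inv, ← div_eq_inv_mul, div_lt_one hne]
  exact lt_of_pow_lt_pow_left₀ 2 hne.le (by linarith)

theorem moebius_moebius {n : ℕ} {a z : CSpace n} (ha : ‖a‖ < 1) (hz : ‖z‖ < 1) :
    moebius a (moebius a z) = z := by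
  have hpos : (0 : ℝ) < 1 - ‖a‖ ^ 2 := by nlinarith [norm_nonneg a]
  have hs := Real.sq_sqrt hpos.le
  have hne := one_sub_inner_ne_zero ha hz
  have hin := inner_moebiusL ha z
  set s : ℝ := √(1 - ‖a‖ ^ 2) with hsdef
  have hs0 : 0 < s := Real.sqrt_pos.mpr hpos
  have hs0' : (s : ℂ) ≠ 0 := by exact_mod_cast hs0.ne'
  have hs1 : (s : ℂ) + 1 ≠ 0 := by
    norm_cast
    positivity
  have haa : inner ℂ a a = (1 - (s : ℂ) ^ 2) := by
    rw [inner_self_eq_coe_norm_sq, show ‖a‖ ^ 2 = 1 - s ^ 2 by linarith]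
    push_cast
    rfl
  have hw : inner ℂ a (moebius a z) = (1 - (s : ℂ) ^ 2 - inner ℂ a z) / (1 - inner ℂ a z) := by
    rw [moebius, inner_smul_right, inner_sub_right, hin, haa, ← div_eq_inv_mul]
  have h1w : 1 - inner ℂ a (moebius a z) = (s : ℂ) ^ 2 / (1 - inner ℂ a z) := by
    rw [hw]
    field_simp
    ring
  rw [moebius, h1w, moebiusL, hw, moebius, moebiusL, ← hsdef]
  match_scalars
  · field_simp
    ring
  · field_simp

theorem moebius_zero {n : ℕ} (a : CSpace n) : moebius a 0 = a := by
  simp [moebius, moebiusL]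

theorem moebius_self {n : ℕ} {a : CSpace n} (ha : ‖a‖ < 1) : moebius a a = 0 := by
  have := moebius_moebius (z := 0) ha (by simp)
  rwa [moebius_zero] at this

/-- The map `L_a` as a linear map. -/
noncomputable def moebiusLinear {n : ℕ} (a : CSpace n) : CSpace n →ₗ[ℂ] CSpace n where
  toFun := moebiusL a
  map_add' x y := by
    simp only [moebiusL, inner_add_right, add_div]
    module
  map_smul' c x := by
    simp only [moebiusL, inner_smul_right, RingHom.id_apply, mul_div_assoc]
    module

theorem moebiusLinear_apply {n : ℕ} (a z : CSpace n) : moebiusLinear a z = moebiusL a z := rfl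

theorem isHolomorphic_moebius {n : ℕ} (a : UnitBall n) :
    IsHolomorphic fun z : UnitBall n => (⟨moebius (a : CSpace n) z, mem_ball_zero_iff.mpr
      (norm_moebius_lt_one (mem_ball_zero_iff.mp a.2) (mem_ball_zero_iff.mp z.2))⟩ :
        UnitBall n) := by
  refine ⟨moebius (a : CSpace n), ?_, fun _ => rfl⟩
  have hi : Differentiable ℂ fun z : CSpace n => inner ℂ (a : CSpace n) z :=
    (innerSL ℂ (a : CSpace n)).differentiable
  have hL : Differentiable ℂ (moebiusL (a : CSpace n)) :=
    (moebiusLinear (a : CSpace n)).toContinuousLinearMap.differentiable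
  exact ((hi.const_sub 1).differentiableOn.inv fun z hz => one_sub_inner_ne_zero
    (mem_ball_zero_iff.mp a.2) (mem_ball_zero_iff.mp hz)).smul (hL.const_sub _).differentiableOn

/-- The involution `φ_a` as an automorphism of the ball. -/
noncomputable def moebiusAut {n : ℕ} (a : UnitBall n) : ballAut n :=
  ⟨{  toFun := fun z => ⟨moebius (a : CSpace n) z, mem_ball_zero_iff.mpr
        (norm_moebius_lt_one (mem_ball_zero_iff.mp a.2) (mem_ball_zero_iff.mp z.2))⟩
      invFun := fun z => ⟨moebius (a : CSpace n) z, mem_ball_zero_iff.mpr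
        (norm_moebius_lt_one (mem_ball_zero_iff.mp a.2) (mem_ball_zero_iff.mp z.2))⟩
      left_inv := fun z => Subtype.ext
        (moebius_moebius (mem_ball_zero_iff.mp a.2) (mem_ball_zero_iff.mp z.2))
      right_inv := fun z => Subtype.ext
        (moebius_moebius (mem_ball_zero_iff.mp a.2) (mem_ball_zero_iff.mp z.2)) },
    isHolomorphic_moebius a, isHolomorphic_moebius a⟩

/-! ### Schwarz lemma and the structure of the automorphism group -/

theorem IsHolomorphic.norm_apply_le {n m : ℕ} {g : UnitBall n → UnitBall m}
    (hg : IsHolomorphic g) (h0 : g (UnitBall.origin n) = UnitBall.origin m) (z : UnitBall n) :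
    ‖(g z : CSpace m)‖ ≤ ‖(z : CSpace n)‖ := by
  obtain ⟨G, hG, hGg⟩ := hg
  rw [← hGg]
  refine Complex.norm_le_norm_of_mapsTo_ball hG (fun w hw => ?_) ?_ (mem_ball_zero_iff.mp z.2)
  · rw [hGg ⟨w, hw⟩]
    exact ball_subset_closedBall (g ⟨w, hw⟩).2
  · have := hGg (UnitBall.origin n)
    rw [h0] at this
    exact this

/-- Equality in the Schwarz lemma on each complex line through 0 makes G linear along that line,
with slope given by the derivative at 0. -/
theorem eq_fderiv_apply_of_norm_eq {n m : ℕ} {G : CSpace n → CSpace m}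
    (hG : DifferentiableOn ℂ G (ball 0 1)) (hnorm : ∀ z ∈ ball 0 1, ‖G z‖ = ‖z‖)
    {z : CSpace n} (hz : z ∈ ball 0 1) : G z = fderiv ℂ G 0 z := by
  have h0 : G 0 = 0 := by simpa using hnorm 0 (by simp)
  rcases eq_or_ne z 0 with rfl | hz0
  · simpa using h0
  have hzpos : 0 < ‖z‖ := norm_pos_iff.mpr hz0
  have hmem : ∀ t ∈ ball (0 : ℂ) (1 / ‖z‖), t • z ∈ ball (0 : CSpace n) 1 := fun t ht => by
    rw [mem_ball_zero_iff] at ht ⊢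
    rwa [norm_smul, ← lt_div_iff₀ hzpos]
  have h1 : (1 : ℂ) ∈ ball (0 : ℂ) (1 / ‖z‖) := by
    rw [mem_ball_zero_iff, norm_one, lt_div_iff₀ hzpos, one_mul]
    exact mem_ball_zero_iff.mp hz
  have hd : DifferentiableOn ℂ (fun t : ℂ => G (t • z)) (ball 0 (1 / ‖z‖)) :=
    hG.comp (differentiable_id.smul_const z).differentiableOn hmem
  -- On the disc of radius 1/‖z‖ the Schwarz bound for the slope is ‖z‖, and it is attained at t =
  -- 1.
  obtain ⟨C, -, hC⟩ := Complex.affine_of_mapsTo_ball_of_exists_norm_dslope_eq_div' (R₂ := 1) hd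
    (fun t ht => by
      have := hnorm _ (hmem t ht)
      simp only [zero_smul, h0, mem_closedBall_zero_iff]
      rw [this]
      exact (mem_ball_zero_iff.mp (hmem t ht)).le)
    ⟨1, h1, by
      rw [dslope_of_ne _ one_ne_zero, slope_def_module]
      simp [h0, hnorm z hz]⟩
  have hCz : G z = C := by simpa [h0] using hC h1
  have hder : HasDerivAt (fun t : ℂ => G (t • z)) (fderiv ℂ G 0 z) 0 := by
    have hf : HasFDerivAt G (fderiv ℂ G 0) ((0 : ℂ) • z) := by
      rw [zero_smul]
      exact (hG.differentiableAt (ball_mem_nhds _ one_pos)).hasFDerivAt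
    have := hf.comp_hasDerivAt (0 : ℂ) ((hasDerivAt_id (0 : ℂ)).smul_const z)
    rwa [one_smul] at this
  have hder' : HasDerivAt (fun t : ℂ => G (t • z)) C 0 := by
    have : HasDerivAt (fun t : ℂ => t • C) C 0 := by
      simpa using (hasDerivAt_id (0 : ℂ)).smul_const C
    refine this.congr_of_eventuallyEq ?_
    filter_upwards [ball_mem_nhds (0 : ℂ) (one_div_pos.mpr hzpos)] with t ht
    simpa [h0] using hC ht
  rw [hCz, hder.unique hder']

theorem LinearMap.norm_apply_eq_of_ball {E F : Type*} [NormedAddCommGroup E] [NormedSpace ℂ E]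
    [NormedAddCommGroup F] [NormedSpace ℂ F] (L : E →ₗ[ℂ] F)
    (h : ∀ z ∈ ball (0 : E) 1, ‖L z‖ = ‖z‖) (z : E) : ‖L z‖ = ‖z‖ := by
  have hpos : 0 < ‖z‖ + 1 := by positivity
  have hn : ‖((‖z‖ + 1 : ℝ) : ℂ)⁻¹‖ = (‖z‖ + 1)⁻¹ := by
    rw [norm_inv, Complex.norm_real, Real.norm_of_nonneg hpos.le]
  -- Dividing by ‖z‖ + 1 instead of ‖z‖ lands in the open ball and covers z = 0.
  have := h (((‖z‖ + 1 : ℝ) : ℂ)⁻¹ • z) (by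
    rw [mem_ball_zero_iff, norm_smul, hn, ← div_eq_inv_mul, div_lt_one hpos]
    linarith)
  rw [map_smul, norm_smul, norm_smul, hn] at this
  exact mul_left_cancel₀ (inv_ne_zero hpos.ne') this

/-- Schwarz applied to g and to its inverse shows that g preserves norms, hence is linear. -/
theorem ballAut.exists_unitary_of_origin {n : ℕ} (g : ballAut n)
    (h0 : g.1 (UnitBall.origin n) = UnitBall.origin n) :
    ∃ V : CSpace n ≃ₗᵢ[ℂ] CSpace n, ∀ z : UnitBall n, (g.1 z : CSpace n) = V z := by
  have hnorm : ∀ z : UnitBall n, ‖(g.1 z : CSpace n)‖ = ‖(z : CSpace n)‖ := fun z => by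
    refine le_antisymm (IsHolomorphic.norm_apply_le g.2.1 h0 z) ?_
    have := IsHolomorphic.norm_apply_le g.2.2 (g.1.symm_apply_eq.mpr h0.symm) (g.1 z)
    rwa [Equiv.symm_apply_apply] at this
  obtain ⟨G, hG, hGg⟩ := g.2.1
  have hn : ∀ z ∈ ball (0 : CSpace n) 1, ‖G z‖ = ‖z‖ := fun z hz => by
    rw [hGg ⟨z, hz⟩, hnorm]
  have hlin : ∀ z ∈ ball (0 : CSpace n) 1, G z = fderiv ℂ G 0 z :=
    fun z hz => eq_fderiv_apply_of_norm_eq hG hn hz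
  have hL : ∀ z, ‖fderiv ℂ G 0 z‖ = ‖z‖ :=
    LinearMap.norm_apply_eq_of_ball (fderiv ℂ G 0).toLinearMap fun z hz =>
      (congrArg norm (hlin z hz)).symm.trans (hn z hz)
  refine ⟨LinearIsometry.toLinearIsometryEquiv ⟨(fderiv ℂ G 0).toLinearMap, hL⟩ rfl, fun z => ?_⟩
  rw [← hGg, hlin z z.2]
  rfl

theorem ballAut.exists_eq_unitary_moebius {n : ℕ} (g : ballAut n) :
    ∃ (V : CSpace n ≃ₗᵢ[ℂ] CSpace n) (a : UnitBall n),
      ∀ z : UnitBall n, (g.1 z : CSpace n) = V (moebius (a : CSpace n) z) := by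
  set a : UnitBall n := g.1.symm (UnitBall.origin n) with ha
  obtain ⟨V, hV⟩ := ballAut.exists_unitary_of_origin (g * moebiusAut a) (by
    have : (moebiusAut a).1 (UnitBall.origin n) = a := Subtype.ext (moebius_zero _)
    rw [Subgroup.coe_mul, Equiv.Perm.mul_apply, this, ha, Equiv.apply_symm_apply])
  refine ⟨V, a, fun z => ?_⟩
  have hz : (moebiusAut a).1 ((moebiusAut a).1 z) = z := Subtype.ext
    (moebius_moebius (mem_ball_zero_iff.mp a.2) (mem_ball_zero_iff.mp z.2))
  have := hV ((moebiusAut a).1 z)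
  rwa [Subgroup.coe_mul, Equiv.Perm.mul_apply, hz] at this

/-! ### Polynomial functions of bounded degree -/

/-- A function on `ℂⁿ` given by a polynomial of total degree at most `d`. -/
def IsPolynomialOfDegreeLE {n : ℕ} (d : ℕ) (h : CSpace n → ℂ) : Prop :=
  ∃ R : MvPolynomial (Fin n) ℂ, R.totalDegree ≤ d ∧ ∀ z, polyEval R z = h z

namespace IsPolynomialOfDegreeLE

variable {n d e : ℕ} {g h : CSpace n → ℂ}

theorem mono (hh : IsPolynomialOfDegreeLE d h) (hde : d ≤ e) : IsPolynomialOfDegreeLE e h := by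
  obtain ⟨R, hR, hRh⟩ := hh
  exact ⟨R, hR.trans hde, hRh⟩

theorem const (d : ℕ) (c : ℂ) : IsPolynomialOfDegreeLE d fun _ : CSpace n => c :=
  ⟨MvPolynomial.C c, by simp, fun z => by simp [polyEval]⟩

theorem coord (i : Fin n) : IsPolynomialOfDegreeLE 1 fun z : CSpace n => z i :=
  ⟨MvPolynomial.X i, by simp, fun z => by simp [polyEval]⟩

theorem polyEval {p : MvPolynomial (Fin n) ℂ} (hp : p.totalDegree ≤ d) :
    IsPolynomialOfDegreeLE d (polyEval p) :=
  ⟨p, hp, fun _ => rfl⟩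

theorem add (hg : IsPolynomialOfDegreeLE d g) (hh : IsPolynomialOfDegreeLE d h) :
    IsPolynomialOfDegreeLE d fun z => g z + h z := by
  obtain ⟨P, hP, hPg⟩ := hg
  obtain ⟨R, hR, hRh⟩ := hh
  refine ⟨P + R, (MvPolynomial.totalDegree_add _ _).trans (max_le hP hR), fun z => ?_⟩
  simp only [← hPg, ← hRh, _root_.polyEval, map_add]

theorem mul (hg : IsPolynomialOfDegreeLE d g) (hh : IsPolynomialOfDegreeLE e h) :
    IsPolynomialOfDegreeLE (d + e) fun z => g z * h z := by
  obtain ⟨P, hP, hPg⟩ := hg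
  obtain ⟨R, hR, hRh⟩ := hh
  refine ⟨P * R, (MvPolynomial.totalDegree_mul _ _).trans (add_le_add hP hR), fun z => ?_⟩
  simp only [← hPg, ← hRh, _root_.polyEval, map_mul]

theorem const_mul (c : ℂ) (hh : IsPolynomialOfDegreeLE d h) :
    IsPolynomialOfDegreeLE d fun z => c * h z :=
  ((const 0 c).mul hh).mono (zero_add d).le

theorem pow (hh : IsPolynomialOfDegreeLE d h) (k : ℕ) :
    IsPolynomialOfDegreeLE (k * d) fun z => h z ^ k := by
  induction k with
  | zero => simpa using const _ 1
  | succ k ih => simpa only [pow_succ, add_mul, one_mul] using ih.mul hh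

theorem sum {ι : Type*} (s : Finset ι) {h : ι → CSpace n → ℂ}
    (hh : ∀ i ∈ s, IsPolynomialOfDegreeLE d (h i)) :
    IsPolynomialOfDegreeLE d fun z => ∑ i ∈ s, h i z := by
  classical
  induction s using Finset.induction_on with
  | empty => simpa using const d 0
  | insert i s hi ih =>
    simpa only [Finset.sum_insert hi] using (hh i (Finset.mem_insert_self i s)).add
      (ih fun j hj => hh j (Finset.mem_insert_of_mem hj))

theorem prod {ι : Type*} (s : Finset ι) {d : ι → ℕ} {h : ι → CSpace n → ℂ}
    (hh : ∀ i ∈ s, IsPolynomialOfDegreeLE (d i) (h i)) :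
    IsPolynomialOfDegreeLE (∑ i ∈ s, d i) fun z => ∏ i ∈ s, h i z := by
  classical
  induction s using Finset.induction_on with
  | empty => simpa using const 0 1
  | insert i s hi ih =>
    simpa only [Finset.prod_insert hi, Finset.sum_insert hi] using
      (hh i (Finset.mem_insert_self i s)).mul (ih fun j hj => hh j (Finset.mem_insert_of_mem hj))

theorem linearMap_comp {m : ℕ} {F : CSpace n → CSpace m}
    (hF : ∀ j, IsPolynomialOfDegreeLE d fun z => F z j) (T : CSpace m →ₗ[ℂ] ℂ) :
    IsPolynomialOfDegreeLE d fun z => T (F z) := by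
  have h := sum Finset.univ fun j _ => (hF j).const_mul (T (EuclideanSpace.single j 1))
  convert h using 2 with z
  conv_lhs => rw [← (EuclideanSpace.basisFun (Fin m) ℂ).sum_repr (F z), map_sum]
  simp [mul_comm]

theorem linearMap (T : CSpace n →ₗ[ℂ] ℂ) : IsPolynomialOfDegreeLE 1 fun z => T z :=
  linearMap_comp coord T

/-- A monomial of degree |k| is padded with g^{d - |k|}; this clears the denominators of p(F/g) and
keeps the degree at most d. -/
theorem homogenize {m : ℕ} {p : MvPolynomial (Fin m) ℂ} (hp : p.totalDegree ≤ d)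
    {F : CSpace n → CSpace m} (hF : ∀ j, IsPolynomialOfDegreeLE 1 fun z => F z j)
    (hg : IsPolynomialOfDegreeLE 1 g) :
    ∃ R : MvPolynomial (Fin n) ℂ, R.totalDegree ≤ d ∧
      ∀ z, g z ≠ 0 → _root_.polyEval R z = g z ^ d * _root_.polyEval p ((g z)⁻¹ • F z) := by
  have hdeg : ∀ k ∈ p.support, ∑ j, k j ≤ d := fun k hk => by
    have := (MvPolynomial.le_totalDegree hk).trans hp
    rwa [Finsupp.sum_fintype _ _ fun _ => rfl] at this
  obtain ⟨R, hR, hRz⟩ := sum (d := d) p.support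
    (h := fun k z => p.coeff k * ((∏ j, F z j ^ k j) * g z ^ (d - ∑ j, k j))) fun k hk => by
      refine (((prod Finset.univ fun j _ => (hF j).pow (k j)).mul (hg.pow _)).const_mul _).mono ?_
      have := hdeg k hk
      simp only [mul_one]
      omega
  refine ⟨R, hR, fun z hz => ?_⟩
  rw [hRz, _root_.polyEval, MvPolynomial.eval_eq', Finset.mul_sum]
  refine Finset.sum_congr rfl fun k hk => ?_
  have hpow : g z ^ d = g z ^ (d - ∑ j, k j) * ∏ j, g z ^ k j := by
    rw [Finset.prod_pow_eq_pow_sum, ← pow_add, Nat.sub_add_cancel (hdeg k hk)]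
  have hprod : ∏ j, ((g z)⁻¹ • F z) j ^ k j = (∏ j, g z ^ k j)⁻¹ * ∏ j, F z j ^ k j := by
    rw [← Finset.prod_inv_distrib, ← Finset.prod_mul_distrib]
    exact Finset.prod_congr rfl fun j _ => by simp [mul_pow]
  have hne : ∏ j, g z ^ k j ≠ 0 := Finset.prod_ne_zero_iff.mpr fun j _ => pow_ne_zero _ hz
  rw [hprod, hpow]
  field_simp

end IsPolynomialOfDegreeLE

/-! ### Polynomial identities and fractions in lowest terms -/

theorem MvPolynomial.eq_of_eqOn_ball {n : ℕ} {P R : MvPolynomial (Fin n) ℂ}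
    (h : ∀ z : UnitBall n, polyEval P z = polyEval R z) : P = R := by
  -- A polydisc of this radius lies in the ball, since n/(n + 1) < 1, also for n = 0.
  have hpos : (0 : ℝ) < 1 / (n + 1) := by positivity
  refine MvPolynomial.funext_set (fun _ => ball (0 : ℂ) (1 / (n + 1)))
    (fun _ => infinite_of_mem_nhds 0 (ball_mem_nhds _ hpos)) fun x hx => ?_
  refine h ⟨WithLp.toLp 2 x, mem_ball_zero_iff.mpr ?_⟩
  have hx' : ∀ i, ‖x i‖ < 1 / (n + 1) := fun i => mem_ball_zero_iff.mp (hx i trivial)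
  have hle : ‖WithLp.toLp 2 x‖ ≤ ∑ i, ‖x i‖ := by
    have hrepr := (EuclideanSpace.basisFun (Fin n) ℂ).sum_repr (WithLp.toLp 2 x)
    rw [← hrepr]
    refine (norm_sum_le _ _).trans (Finset.sum_le_sum fun i _ => ?_)
    simp [norm_smul]
  refine hle.trans_lt ?_
  calc ∑ i, ‖x i‖ ≤ ∑ _i : Fin n, (1 / (n + 1) : ℝ) := Finset.sum_le_sum fun i _ => (hx' i).le
    _ = n / (n + 1) := by simp [div_eq_mul_inv]
    _ < 1 := by rw [div_lt_one (by positivity)]; linarith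

/-- q is coprime to the gcd of the p j and divides x times that gcd. -/
theorem dvd_of_forall_dvd_mul {α ι : Type*} [CommRing α] [IsDomain α]
    [UniqueFactorizationMonoid α] [Fintype ι] {q x : α} {p : ι → α}
    (h : ∀ r, (∀ j, r ∣ p j) → r ∣ q → IsUnit r) (hx : ∀ j, q ∣ x * p j) : q ∣ x := by
  classical
  let : StrongNormalizationMonoid α := UniqueFactorizationMonoid.strongNormalizationMonoid
  let := UniqueFactorizationMonoid.toNormalizedGCDMonoid α
  have hrel : IsRelPrime q (Finset.univ.gcd p) := fun r hq hr =>
    h r (fun j => hr.trans (Finset.gcd_dvd (Finset.mem_univ j))) hq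
  refine hrel.dvd_of_dvd_mul_right ?_
  have hdvd : q ∣ Finset.univ.gcd fun j => x * p j := Finset.dvd_gcd fun j _ => hx j
  exact hdvd.trans (Finset.gcd_mul_left' Finset.univ p x).dvd

theorem exists_eq_C_mul_of_lowest_terms {n N : ℕ} {p R : Fin N → MvPolynomial (Fin n) ℂ}
    {q S : MvPolynomial (Fin n) ℂ}
    (hlow : ∀ r : MvPolynomial (Fin n) ℂ, (∀ j, r ∣ p j) → r ∣ q → IsUnit r)
    (hq : q ≠ 0) (hcross : ∀ j, q * R j = S * p j)
    (hR : ∀ j, (R j).totalDegree ≤ fractionDegree p q)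
    (hS : S.totalDegree ≤ fractionDegree p q) :
    ∃ c : ℂ, S = MvPolynomial.C c * q ∧ ∀ j, R j = MvPolynomial.C c * p j := by
  obtain ⟨g, rfl⟩ : q ∣ S :=
    dvd_of_forall_dvd_mul hlow fun j => ⟨R j, (hcross j).symm⟩
  have hRg : ∀ j, R j = g * p j := fun j => mul_left_cancel₀ hq (by rw [hcross]; ring)
  suffices hg : g.totalDegree = 0 by
    rw [MvPolynomial.totalDegree_eq_zero_iff_eq_C] at hg
    exact ⟨_, by rw [← hg, mul_comm], fun j => by rw [← hg, hRg]⟩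
  -- The zero polynomial has `totalDegree` 0, so c = 0 is allowed.
  by_cases hg0 : g = 0
  · simp [hg0]
  rw [MvPolynomial.totalDegree_mul_of_isDomain hq hg0] at hS
  rcases Nat.eq_zero_or_pos g.totalDegree with h | h
  · exact h
  -- A cofactor of positive degree would leave q and every p j with degree below their own maximum.
  have hbound : fractionDegree p q ≤ fractionDegree p q - g.totalDegree := by
    refine max_le (Finset.sup_le fun j _ => ?_) (by omega)
    by_cases hp : p j = 0
    · simp [hp]
    have := hR j
    rw [hRg, MvPolynomial.totalDegree_mul_of_isDomain hg0 hp] at this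
    omega
  omega

/-! ### Transformation of the Hermitian form -/

open Filter Topology

theorem polyMap_apply {n N : ℕ} (p : Fin N → MvPolynomial (Fin n) ℂ) (z : CSpace n) (j : Fin N) :
    polyMap p z j = polyEval (p j) z := rfl

theorem polyEval_mul {n : ℕ} (P R : MvPolynomial (Fin n) ℂ) (z : CSpace n) :
    polyEval (P * R) z = polyEval P z * polyEval R z := map_mul _ _ _

theorem polyEval_C_mul {n : ℕ} (c : ℂ) (P : MvPolynomial (Fin n) ℂ) (z : CSpace n) :
    polyEval (MvPolynomial.C c * P) z = c * polyEval P z := by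
  simp [polyEval]

/-- The Hermitian form `|q|² - ‖p‖²` of `f = p / q` is transformed by an element of `Γ_f` into a
positive constant multiple of itself, up to the expected factor. -/
theorem exists_hermitianForm_transformation {n N : ℕ} {f : UnitBall n → UnitBall N}
    {p : Fin N → MvPolynomial (Fin n) ℂ} {q : MvPolynomial (Fin n) ℂ}
    (hf : IsReducedFraction f p q) {γ : ballAut n} (hγ : γ ∈ hermitianInvariantGroup f)
    {U : CSpace n ≃ₗᵢ[ℂ] CSpace n} {a : UnitBall n}
    (hU : ∀ z : UnitBall n, (γ.1 z : CSpace n) = U (moebius (a : CSpace n) z)) :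
    ∃ A B : ℝ, 0 < B ∧ ∀ z : UnitBall n,
      A * (‖polyEval q z‖ ^ 2 - ‖polyMap p z‖ ^ 2) =
        B * (‖1 - inner ℂ (a : CSpace n) z‖ ^ (2 * fractionDegree p q) *
          (‖polyEval q (γ.1 z)‖ ^ 2 - ‖polyMap p (γ.1 z)‖ ^ 2)) := by
  obtain ⟨ψ, hψ⟩ := hγ
  obtain ⟨V, b, hV⟩ := ballAut.exists_eq_unitary_moebius ψ⁻¹
  have hfV : ∀ z, (f z : CSpace N) = V (moebius (b : CSpace N) (f (γ.1 z))) := fun z => by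
    rw [← hV, hψ, Subgroup.coe_inv, Equiv.Perm.inv_def, Equiv.symm_apply_apply]
  have hb := mem_ball_zero_iff.mp b.2
  set d := fractionDegree p q
  set F : CSpace n → CSpace n := fun z => U (a - moebiusL (a : CSpace n) z) with hFdef
  set g : CSpace n → ℂ := fun z => 1 - inner ℂ (a : CSpace n) z with hgdef
  have hg0 : ∀ z : UnitBall n, g z ≠ 0 := fun z =>
    one_sub_inner_ne_zero (mem_ball_zero_iff.mp a.2) (mem_ball_zero_iff.mp z.2)
  have hγF : ∀ z : UnitBall n, (g z)⁻¹ • F z = γ.1 z := fun z => by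
    rw [hU, moebius, map_smul]
  have hF : ∀ j, IsPolynomialOfDegreeLE 1 fun z => F z j := fun j => by
    have := (IsPolynomialOfDegreeLE.const 1 (U a j)).add ((IsPolynomialOfDegreeLE.linearMap
      ((EuclideanSpace.proj j).toLinearMap ∘ₗ U.toLinearEquiv.toLinearMap ∘ₗ
        moebiusLinear (a : CSpace n))).const_mul (-1))
    convert this using 2 with z
    simp [hFdef, moebiusLinear_apply, sub_eq_add_neg]
  have hg : IsPolynomialOfDegreeLE 1 g := by
    have := (IsPolynomialOfDegreeLE.const 1 1).add ((IsPolynomialOfDegreeLE.linearMap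
      (innerSL ℂ (a : CSpace n)).toLinearMap).const_mul (-1))
    convert this using 2 with z
    simp [hgdef, sub_eq_add_neg]
  have hpd : ∀ j, (p j).totalDegree ≤ d := fun j =>
    (Finset.le_sup (f := fun j => (p j).totalDegree) (Finset.mem_univ j)).trans (le_max_left _ _)
  have hqd : q.totalDegree ≤ d := le_max_right _ _
  choose P hPd hP using fun j => IsPolynomialOfDegreeLE.homogenize (hpd j) hF hg
  obtain ⟨Q, hQd, hQ⟩ := IsPolynomialOfDegreeLE.homogenize hqd hF hg
  have hPγ : ∀ z : UnitBall n, polyMap P z = g z ^ d • polyMap p (γ.1 z) := fun z => by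
    ext j
    rw [polyMap_apply, hP j z (hg0 z), hγF, PiLp.smul_apply, polyMap_apply, smul_eq_mul]
  have hQγ : ∀ z : UnitBall n, polyEval Q z = g z ^ d * polyEval q (γ.1 z) := fun z => by
    rw [hQ z (hg0 z), hγF]
  have hPQ : ∀ z : UnitBall n, polyMap P z = polyEval Q z • (f (γ.1 z) : CSpace N) := fun z => by
    rw [hPγ, hQγ, mul_smul, hf.eq_div]
  have hPcoord : ∀ j, IsPolynomialOfDegreeLE d fun z => polyMap P z j := fun j =>
    IsPolynomialOfDegreeLE.polyEval (hPd j)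
  -- R and S are the numerator and denominator of V ∘ φ_b at P/Q. Both are linear in (Q, P), so the
  -- degree bound d survives.
  have hR : ∀ j, IsPolynomialOfDegreeLE d fun z =>
      V (polyEval Q z • (b : CSpace N) - moebiusL (b : CSpace N) (polyMap P z)) j := fun j => by
    obtain ⟨R, hR, h⟩ := ((IsPolynomialOfDegreeLE.polyEval hQd).const_mul (V b j)).add
      ((IsPolynomialOfDegreeLE.linearMap_comp hPcoord
      ((EuclideanSpace.proj j).toLinearMap ∘ₗ V.toLinearEquiv.toLinearMap ∘ₗ
        moebiusLinear (b : CSpace N))).const_mul (-1))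
    exact ⟨R, hR, fun z => (h z).trans (by
      simp [moebiusLinear_apply, sub_eq_add_neg, mul_comm])⟩
  have hS : IsPolynomialOfDegreeLE d fun z =>
      polyEval Q z - inner ℂ (b : CSpace N) (polyMap P z) := by
    obtain ⟨S, hS, h⟩ := (IsPolynomialOfDegreeLE.polyEval hQd).add
      ((IsPolynomialOfDegreeLE.linearMap_comp hPcoord (innerSL ℂ (b : CSpace N)).toLinearMap).const_mul (-1))
    exact ⟨S, hS, fun z => (h z).trans (by simp [sub_eq_add_neg])⟩
  choose R hRd hR using hR
  obtain ⟨S, hSd, hS⟩ := hS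
  beta_reduce at hS
  have hRmap : ∀ z, polyMap R z =
      V (polyEval Q z • (b : CSpace N) - moebiusL (b : CSpace N) (polyMap P z)) := fun z => by
    ext j
    exact hR j z
  have hcross : ∀ z : UnitBall n, polyEval q z • polyMap R z = polyEval S z • polyMap p z := by
    intro z
    have hne : 1 - inner ℂ (b : CSpace N) (f (γ.1 z) : CSpace N) ≠ 0 :=
      one_sub_inner_ne_zero hb (mem_ball_zero_iff.mp (f (γ.1 z)).2)
    have hRf : polyMap R z = polyEval S z • (f z : CSpace N) := by
      rw [hRmap, hS, hPQ, hfV z, moebius, ← moebiusLinear_apply, ← moebiusLinear_apply,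
        map_smul (moebiusLinear _), ← smul_sub, map_smul, map_smul, smul_smul, inner_smul_right]
      congr 1
      field_simp
    rw [hRf, smul_comm, hf.eq_div]
  have hq0 : q ≠ 0 := fun h => by simpa [h, polyEval] using hf.denom_zero
  obtain ⟨c, hSc, hRc⟩ := exists_eq_C_mul_of_lowest_terms hf.lowest_terms hq0
    (fun j => MvPolynomial.eq_of_eqOn_ball fun z => by
      rw [polyEval_mul, polyEval_mul]
      exact congrArg (fun w : CSpace N => w j) (hcross z)) hRd hSd
  have hRc' : ∀ z, polyMap R z = c • polyMap p z := fun z => by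
    ext j
    rw [polyMap_apply, hRc, polyEval_C_mul]
    rfl
  refine ⟨‖c‖ ^ 2, 1 - ‖(b : CSpace N)‖ ^ 2, by nlinarith [norm_nonneg (b : CSpace N)],
    fun z => ?_⟩
  have key := norm_sq_sub_moebiusL hb (polyEval Q z) (polyMap P z)
  rw [← hS, ← V.norm_map, ← hRmap, hRc', hSc, polyEval_C_mul, hPγ, hQγ] at key
  simp only [norm_mul, norm_smul, norm_pow] at key
  simp only [pow_mul', hgdef] at key ⊢
  linear_combination key

theorem hermitianForm_mul_eq {n N : ℕ} {f : UnitBall n → UnitBall N}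
    {p : Fin N → MvPolynomial (Fin n) ℂ} {q : MvPolynomial (Fin n) ℂ}
    (hf : IsReducedFraction f p q) (hf0 : f (UnitBall.origin n) = UnitBall.origin N)
    {γ : ballAut n} (hγ : γ ∈ hermitianInvariantGroup f)
    {U : CSpace n ≃ₗᵢ[ℂ] CSpace n} {a : UnitBall n}
    (hU : ∀ z : UnitBall n, (γ.1 z : CSpace n) = U (moebius (a : CSpace n) z)) :
    (‖polyMap p a‖ ^ 2 - ‖polyEval q a‖ ^ 2) *
      (‖polyMap p (U a)‖ ^ 2 - ‖polyEval q (U a)‖ ^ 2) =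
        (1 - ‖(a : CSpace n)‖ ^ 2) ^ (2 * fractionDegree p q) := by
  obtain ⟨A, B, hB, h⟩ := exists_hermitianForm_transformation hf hγ hU
  have ha := mem_ball_zero_iff.mp a.2
  have hp0 : polyMap p 0 = 0 := by
    have := hf.eq_div (UnitBall.origin n)
    rw [hf0] at this
    exact this.symm.trans (smul_zero _)
  -- At 0 the relation reads A = B H(Ua); at a it reads A H(a) = B (1 - ‖a‖²)^{2d}.
  have h0 := h (UnitBall.origin n)
  have h1 := h a
  have hγ0 : (γ.1 (UnitBall.origin n) : CSpace n) = U a := by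
    rw [hU]
    exact congrArg U (moebius_zero _)
  have hγa : (γ.1 a : CSpace n) = 0 := by rw [hU, moebius_self ha, map_zero]
  have horig : (UnitBall.origin n : CSpace n) = 0 := rfl
  have haa : ‖1 - inner ℂ (a : CSpace n) a‖ = 1 - ‖(a : CSpace n)‖ ^ 2 := by
    rw [inner_self_eq_coe_norm_sq, ← Complex.ofReal_one, ← Complex.ofReal_sub, Complex.norm_real,
      Real.norm_of_nonneg (by nlinarith [norm_nonneg (a : CSpace n)])]
  rw [hγ0, horig, hp0, hf.denom_zero] at h0
  rw [hγa, hp0, hf.denom_zero, haa] at h1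
  simp only [norm_one, norm_zero, one_pow, inner_zero_right, sub_zero] at h0 h1
  refine mul_left_cancel₀ hB.ne' ?_
  simp only [ne_eq, OfNat.ofNat_ne_zero, not_false_eq_true, zero_pow, sub_zero, mul_one,
    one_mul] at h0 h1
  rw [← h1, h0]
  ring

/-! ### Polynomial maps and linear isometries -/

/-- From p j = q P j, the denominator is a common factor, hence a constant, and q(0) = 1 fixes it.
-/
theorem eq_one_of_eq_polyMap {n N : ℕ} {f : UnitBall n → UnitBall N}
    {p : Fin N → MvPolynomial (Fin n) ℂ} {q : MvPolynomial (Fin n) ℂ}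
    (hf : IsReducedFraction f p q) {P : Fin N → MvPolynomial (Fin n) ℂ}
    (hP : ∀ z : UnitBall n, (f z : CSpace N) = polyMap P z) : q = 1 := by
  have hpP : ∀ j, p j = q * P j := fun j => MvPolynomial.eq_of_eqOn_ball fun z => by
    have := congrArg (fun w : CSpace N => w j) (hf.eq_div z)
    rw [hP] at this
    rw [polyEval_mul]
    exact this.symm
  have hunit := hf.lowest_terms q (fun j => hpP j ▸ dvd_mul_right _ _) dvd_rfl
  obtain ⟨c, hc, rfl⟩ := MvPolynomial.isUnit_iff_eq_C_of_isReduced.mp hunit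
  have : c = 1 := by simpa [polyEval] using hf.denom_zero
  rw [this, map_one]

theorem polyEval_smul_of_totalDegree_le_one {n : ℕ} {p : MvPolynomial (Fin n) ℂ}
    (hp : p.totalDegree ≤ 1) (h0 : polyEval p 0 = 0) (c : ℂ) (z : CSpace n) :
    polyEval p (c • z) = c * polyEval p z := by
  rw [polyEval, polyEval, MvPolynomial.eval_eq', MvPolynomial.eval_eq', Finset.mul_sum]
  refine Finset.sum_congr rfl fun k hk => ?_
  have hk1 : ∑ j, k j ≤ 1 := by
    have := (MvPolynomial.le_totalDegree hk).trans hp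
    rwa [Finsupp.sum_fintype _ _ fun _ => rfl] at this
  have hk0 : k ≠ 0 := by
    rintro rfl
    refine MvPolynomial.mem_support_iff.mp hk ?_
    rw [← MvPolynomial.constantCoeff_eq, ← MvPolynomial.eval_zero]
    exact h0
  have hsum : ∑ j, k j = 1 := by
    refine le_antisymm hk1 (Nat.one_le_iff_ne_zero.mpr fun h => hk0 ?_)
    ext j
    exact Finset.sum_eq_zero_iff.mp h j (Finset.mem_univ j)
  have hc : ∏ j, c ^ k j = c := by rw [Finset.prod_pow_eq_pow_sum, hsum, pow_one]
  simp only [PiLp.smul_apply, smul_eq_mul, mul_pow, Finset.prod_mul_distrib, hc]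
  ring

theorem differentiable_polyMap {n N : ℕ} (p : Fin N → MvPolynomial (Fin n) ℂ) :
    Differentiable ℂ (polyMap p) := by
  rw [differentiable_euclidean]
  intro j
  simp only [polyMap_apply, polyEval, MvPolynomial.eval_eq']
  fun_prop

/-- If ‖G z‖ < 1, the radius towards z is mapped into a compact ball inside the target. Its preimage
is compact, so it would contain the boundary point z. -/
theorem one_le_norm_of_isProperMap {n N : ℕ} {f : UnitBall n → UnitBall N} (hf : IsProperMap f)
    {G : CSpace n → CSpace N} (hfG : ∀ z : UnitBall n, (f z : CSpace N) = G z)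
    (hle : ∀ z : CSpace n, ‖z‖ = 1 → ∀ t : ℝ, 0 ≤ t → t < 1 → ‖G ((t : ℂ) • z)‖ ≤ ‖G z‖)
    {z : CSpace n} (hz : ‖z‖ = 1) : 1 ≤ ‖G z‖ := by
  by_contra! hlt
  have hK : IsCompact {w : UnitBall N | ‖(w : CSpace N)‖ ≤ ‖G z‖} := by
    rw [Subtype.isCompact_iff]
    have himage : Subtype.val '' {w : UnitBall N | ‖(w : CSpace N)‖ ≤ ‖G z‖} =
        closedBall (0 : CSpace N) ‖G z‖ := by
      ext w
      rw [mem_closedBall_zero_iff]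
      constructor
      · rintro ⟨w, hw, rfl⟩
        exact hw
      · exact fun h => ⟨⟨w, mem_ball_zero_iff.mpr (h.trans_lt hlt)⟩, h, rfl⟩
    rw [himage]
    exact isCompact_closedBall _ _
  have hpre := ((hf.isCompact_preimage hK).image continuous_subtype_val).isClosed
  have hlim : Tendsto (fun t : ℝ => (t : ℂ) • z) (𝓝[<] 1) (𝓝 z) := by
    have hc : Continuous fun t : ℝ => (t : ℂ) • z := by fun_prop
    have := hc.tendsto 1
    rw [Complex.ofReal_one, one_smul] at this
    exact this.mono_left nhdsWithin_le_nhds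
  obtain ⟨w, -, hw⟩ := hpre.mem_of_tendsto hlim (by
    filter_upwards [Ioo_mem_nhdsLT (zero_lt_one : (0 : ℝ) < 1)] with t ht
    have hmem : (t : ℂ) • z ∈ ball (0 : CSpace n) 1 := by
      rw [mem_ball_zero_iff, norm_smul, hz, mul_one, Complex.norm_real,
        Real.norm_of_nonneg ht.1.le]
      exact ht.2
    refine ⟨⟨_, hmem⟩, ?_, rfl⟩
    rw [Set.mem_preimage, Set.mem_ofPred_eq, hfG]
    exact hle z hz t ht.1.le ht.2)
  have := mem_ball_zero_iff.mp w.2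
  rw [hw, hz] at this
  exact lt_irrefl _ this

/-- The map `z ↦ z ⊕ 0` as a linear isometry. -/
noncomputable def sumZeroIsometry {n N : ℕ} (h : n ≤ N) : CSpace n →ₗᵢ[ℂ] CSpace N where
  toFun := sumZero n N
  map_add' x y := by
    ext j
    by_cases hj : (j : ℕ) < n <;> simp [sumZero, hj]
  map_smul' c x := by
    ext j
    by_cases hj : (j : ℕ) < n <;> simp [sumZero, hj]
  norm_map' x := by
    obtain ⟨k, rfl⟩ := Nat.exists_eq_add_of_le h
    rw [← sq_eq_sq₀ (norm_nonneg _) (norm_nonneg _), EuclideanSpace.norm_sq_eq,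
      EuclideanSpace.norm_sq_eq]
    change ∑ j, ‖sumZero n (n + k) x j‖ ^ 2 = _
    rw [Fin.sum_univ_add]
    simp [sumZero]

theorem LinearIsometry.exists_eq_comp_sumZero {n N : ℕ} (L : CSpace n →ₗᵢ[ℂ] CSpace N) :
    n ≤ N ∧ ∃ V : CSpace N ≃ₗᵢ[ℂ] CSpace N, ∀ z, L z = V (sumZero n N z) := by
  have hnN : n ≤ N := by
    simpa using LinearMap.finrank_le_finrank_of_injective (f := L.toLinearMap) L.injective
  -- L composed with the inverse of z ↦ z ⊕ 0 is an isometry on a subspace of ℂᴺ; it extends to a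
  -- unitary map.
  refine ⟨hnN, (L.comp (sumZeroIsometry hnN).equivRange.symm.toLinearIsometry).extend
    |>.toLinearIsometryEquiv rfl, fun z => ?_⟩
  have := LinearIsometry.extend_apply
    (L.comp (sumZeroIsometry hnN).equivRange.symm.toLinearIsometry)
    ((sumZeroIsometry hnN).equivRange z)
  simp only [LinearIsometry.coe_comp, Function.comp_apply,
    LinearIsometryEquiv.coe_toLinearIsometry, LinearIsometryEquiv.symm_apply_apply] at this
  exact this.symm

theorem unitarilyEquivalent_sumZero_of_totalDegree_le_one {n N : ℕ} {f : UnitBall n → UnitBall N}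
    (hol : IsHolomorphic f) (proper : IsProperMap f)
    (hf0 : f (UnitBall.origin n) = UnitBall.origin N) {p : Fin N → MvPolynomial (Fin n) ℂ}
    (hfp : ∀ z : UnitBall n, (f z : CSpace N) = polyMap p z) (hp : ∀ j, (p j).totalDegree ≤ 1) :
    n ≤ N ∧ UnitarilyEquivalent f (sumZero n N) := by
  have hp0 : polyMap p 0 = 0 := by
    have := hfp (UnitBall.origin n)
    rw [hf0] at this
    exact this.symm
  have hsmul : ∀ (c : ℂ) (z : CSpace n), polyMap p (c • z) = c • polyMap p z := fun c z => by
    ext j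
    exact polyEval_smul_of_totalDegree_le_one (hp j)
      (congrArg (fun w : CSpace N => w j) hp0) c z
  have hsphere : ∀ z : CSpace n, ‖z‖ = 1 → 1 ≤ ‖polyMap p z‖ := fun z hz => by
    refine one_le_norm_of_isProperMap proper hfp
      (fun w _ t ht0 ht1 => ?_) hz
    rw [hsmul, norm_smul, Complex.norm_real, Real.norm_of_nonneg ht0]
    exact mul_le_of_le_one_left (norm_nonneg _) ht1.le
  have hnorm : ∀ z ∈ ball (0 : CSpace n) 1, ‖polyMap p z‖ = ‖z‖ := fun z hz => by
    refine le_antisymm ?_ ?_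
    · have := hol.norm_apply_le hf0 ⟨z, hz⟩
      rwa [hfp] at this
    · rcases eq_or_ne z 0 with rfl | hz0
      · simp
      have hpos := norm_pos_iff.mpr hz0
      have hn : ‖((‖z‖ : ℂ)⁻¹)‖ = ‖z‖⁻¹ := by simp
      have := hsphere ((‖z‖ : ℂ)⁻¹ • z) (by rw [norm_smul, hn, inv_mul_cancel₀ hpos.ne'])
      rwa [hsmul, norm_smul, hn, ← div_eq_inv_mul, one_le_div hpos] at this
  have hlin : ∀ z ∈ ball (0 : CSpace n) 1, polyMap p z = fderiv ℂ (polyMap p) 0 z :=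
    fun z hz => eq_fderiv_apply_of_norm_eq (differentiable_polyMap p).differentiableOn hnorm hz
  have hL : ∀ z, ‖fderiv ℂ (polyMap p) 0 z‖ = ‖z‖ :=
    LinearMap.norm_apply_eq_of_ball (fderiv ℂ (polyMap p) 0).toLinearMap fun z hz =>
      (congrArg norm (hlin z hz)).symm.trans (hnorm z hz)
  obtain ⟨hnN, V, hV⟩ := LinearIsometry.exists_eq_comp_sumZero
    ⟨(fderiv ℂ (polyMap p) 0).toLinearMap, hL⟩
  refine ⟨hnN, V, LinearIsometryEquiv.refl ℂ _, fun z => ?_⟩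
  rw [hfp, hlin z z.2]
  exact hV z

theorem theorem3p2 (n N d : ℕ) (f : UnitBall n → UnitBall N)
    (hol : IsHolomorphic f) (proper : IsProperMap f)
    (p : Fin N → MvPolynomial (Fin n) ℂ) (q : MvPolynomial (Fin n) ℂ)
    (hf : IsReducedFraction f p q) (hd : fractionDegree p q = d)
    (hf0 : f (UnitBall.origin n) = UnitBall.origin N)
    (γ : ballAut n) (hγ : γ ∈ hermitianInvariantGroup f)
    (hmove : γ.1 (UnitBall.origin n) ≠ UnitBall.origin n) :
    (∀ (U : CSpace n ≃ₗᵢ[ℂ] CSpace n) (a : UnitBall n),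
      (∀ z : UnitBall n, (γ.1 z : CSpace n) = U (moebius (a : CSpace n) z)) →
        (‖polyMap p a‖ ^ 2 - ‖polyEval q a‖ ^ 2) *
            (‖polyMap p (U a)‖ ^ 2 - ‖polyEval q (U a)‖ ^ 2) =
          (1 - ‖(a : CSpace n)‖ ^ 2) ^ (2 * d)) ∧
    ((∃ P : Fin N → MvPolynomial (Fin n) ℂ, ∀ z : UnitBall n, (f z : CSpace N) = polyMap P z) →
      n ≤ N ∧ UnitarilyEquivalent f (sumZero n N)) := by
  subst hd
  refine ⟨fun U a hU => hermitianForm_mul_eq hf hf0 hγ hU, ?_⟩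
  rintro ⟨P, hP⟩
  obtain rfl := eq_one_of_eq_polyMap hf hP
  have hq1 : ∀ z : CSpace n, polyEval 1 z = 1 := fun z => map_one _
  have hfp : ∀ z : UnitBall n, (f z : CSpace N) = polyMap p z := fun z => by
    rw [← hf.eq_div, hq1, one_smul]
  refine unitarilyEquivalent_sumZero_of_totalDegree_le_one hol proper hf0 hfp fun j => ?_
  have hpj : (p j).totalDegree ≤ fractionDegree p 1 :=
    (Finset.le_sup (f := fun j => (p j).totalDegree) (Finset.mem_univ j)).trans (le_max_left _ _)
  refine hpj.trans ?_
  obtain ⟨U, a, hU⟩ := ballAut.exists_eq_unitary_moebius γ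
  have ha := mem_ball_zero_iff.mp a.2
  have ha0 : (a : CSpace n) ≠ 0 := fun h => hmove (Subtype.ext (by
    rw [hU, h]
    simp [UnitBall.origin, moebius_zero]))
  have hUa : ‖U (a : CSpace n)‖ = ‖(a : CSpace n)‖ := U.norm_map _
  have key := hermitianForm_mul_eq hf hf0 hγ hU
  have h1 := hol.norm_apply_le hf0 a
  have h2 := hol.norm_apply_le hf0 ⟨U a, mem_ball_zero_iff.mpr (hUa.trans_lt ha)⟩
  rw [hfp] at h1 h2
  simp only [hUa] at h2
  rw [hq1, hq1, norm_one] at key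
  have hpos : 0 < ‖(a : CSpace n)‖ := norm_pos_iff.mpr ha0
  have hu0 : 0 < 1 - ‖(a : CSpace n)‖ ^ 2 := by nlinarith
  have hu1 : 1 - ‖(a : CSpace n)‖ ^ 2 < 1 := by nlinarith
  have e1 := pow_le_pow_left₀ (norm_nonneg _) h1 2
  have e2 := pow_le_pow_left₀ (norm_nonneg _) h2 2
  -- Both factors in `key` are negative, so the Schwarz bounds `e1` and `e2` bound their product
  -- from below.
  have hle : (1 - ‖(a : CSpace n)‖ ^ 2) ^ 2 ≤
      (1 - ‖(a : CSpace n)‖ ^ 2) ^ (2 * fractionDegree p 1) := by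
    rw [← key]
    nlinarith
  -- The base lies strictly between 0 and 1, so the exponents compare in reverse: 2d ≤ 2.
  have := (pow_le_pow_iff_right_of_lt_one₀ hu0 hu1).mp hle
  omega
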